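/- **O-graphs.** An o-graph is a finite 4-valent graph (loops and multiple edges allowed) together with a planar neighbourhood of each vertex, in which two opposite ends of edges form an over-strand and the other two an under-strand, and a colour in $\mathbb{Z}/3$ on each edge. Number the four ends at a vertex counterclockwise by $i\in\mathbb{Z}/4$, so that $0,2$ form the over-strand and $1,3$ the under-strand. An o-graph $\Gamma$ defines an oriented standard polyhedron $P$ as follows. For each vertex take a copy of $$B=\{x\in[0,1]^4 : \text{at most two coordinates } x_i \text{ are non-zero}\},$$ where the $i$-th axis is the half-edge $i$, the square on the axes $i,i+1$ is the horizontal quadrant between the ends $i$ and $i+1$, the square on the axes $0,2$ is a wing attached from above along the over-strand, and the square on the axes $1,3$ is a wing attached from below along the under-strand. For each end $i$, the tripod $\{x_i=1\}$ has three legs, one in each of the sheets incident to the half-edge $i$; number them by $g\in\mathbb{Z}/3$, starting with $g=0$ in the wing and going on counterclockwise as seen from the vertex looking outwards along the half-edge $i$. For each edge of colour $c$, glue the tripods at its two ends to each other, the leg number $g$ of one to the leg number $c-g$ of the other for each $g\in\mathbb{Z}/3$, preserving the coordinate along the legs. (Thus colour $0$ joins the wings to each other, and colour $c$ adds a right-handed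 screw of $c$ thirds of a turn.) The quotient space is $P$. Its singular set $S(P)$ is the graph formed by the images of the coordinate axes, and the faces of $P$ are the connected components of $P\setminus S(P)$. **The open chain.** Let $n\geqslant 1$, and let $G_n$ be the graph with vertices $v_1,\dots,v_n$, one closed edge at $v_1$, one closed edge at $v_n$, and two edges joining $v_k$ to $v_{k+1}$ for $k=1,\dots,n-1$. Draw the vertices from left to right on a line, each with an upper left, a lower left, a lower right and an upper right end, listed counterclockwise, where the strand from upper left to lower right is over the other one. The closed edge at $v_1$ joins its two left ends and has colour $\alpha$; the closed edge at $v_n$ joins its two right ends and has colour $\delta$; for $k=1,\dots,n-1$ the upper right end of $v_k$ is joined to the upper left end of $v_{k+1}$ by an edge of colour $\beta_k$, and the lower right end of $v_k$ is joined to the lower left end of $v_{k+1}$ by an edge of colour $\gamma_k$. Here $\alpha,\delta,\beta_k,\gamma_k\in\mathbb{Z}/3$ are arbitrary. **The automaton.** Its alphabet is $A=(\mathbb{Z}/3)^2=A_0\cup A_1\cup A_2\cup A_3$, where $$A_0=\{(2,2)\},\quad A_1=\{(0,0),(1,1)\},\quad A_2=\{(1,0),(0,1)\},\quad A_3=\{(0,2),(1,2),(2,0),(2,1)\}.$$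 Its states are $XYYX$ (the start state), $XXYY$, $XYXY$ and $\mathrm{FAIL}$; the accept states are $XXYY$ and $XYXY$. The transitions are: - from $XYYX$: letters in $A_2\cup A_3$ lead to $XXYY$, and letters in $A_0\cup A_1$ to $\mathrm{FAIL}$; - from $XXYY$: letters in $A_1$ lead to $XYYX$, letters in $A_2$ to $XXYY$, letters in $A_3$ to $XYXY$, and letters in $A_0$ to $\mathrm{FAIL}$; - from $XYXY$: letters in $A_1\cup A_3$ lead to $XYYX$, and letters in $A_0\cup A_2$ to $\mathrm{FAIL}$; - from $\mathrm{FAIL}$: all letters lead to $\mathrm{FAIL}$. **Theorem 2.2.** The oriented standard polyhedron defined by the o-graph on $G_n$ with colours $\alpha,\delta,\beta_1,\gamma_1,\dots,\beta_{n-1},\gamma_{n-1}$ described above has a single face if and only if $\alpha\neq 2$, $\delta\neq 2$, and the word $$(\beta_1,\gamma_1)(\beta_2,\gamma_2)\cdots(\beta_{n-1},\gamma_{n-1})$$ is accepted by the automaton. -/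

import Mathlib

/-- An o-graph with vertex set `V`: a 4-valent graph (loops and multiple edges allowed), together
with a planar neighbourhood of each vertex, two opposite strands of which are marked as over the
other two, and a colour in `ℤ/3` on each edge.

The four ends of edges at a vertex `v` are the pairs `(v, i)` with `i : Fin 4` (arithmetic in
`Fin 4` is modulo 4): they are numbered counterclockwise in the planar picture, starting
from an end of the over-strand, so that `0, 2` form the over-strand and `1, 3` the under-strand.
An edge is a pair of distinct ends which are exchanged by `opp`. -/
structure OGraph (V : Type*) where
  finite_vertices : Finite V
  /-- The other end of the edge that starts at a given end. -/
  opp : V × Fin 4 → V × Fin 4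
  opp_opp : ∀ h, opp (opp h) = h
  opp_ne : ∀ h, opp h ≠ h
  /-- The colour of the edge that starts at a given end. -/
  colour : V × Fin 4 → ZMod 3
  colour_opp : ∀ h, colour (opp h) = colour h

/-- The neighbourhood of a vertex of a standard polyhedron, as a subset of the cube `[0,1]^4` whose
four axes are the half-edges at the vertex: the points with at most two nonzero coordinates (the
cone over the 1-skeleton of the tetrahedron). The origin is the vertex, the four axes are the
half-edges, and the six coordinate squares `{i, j}` are the six local sheets.

For a vertex of an o-graph, the square `{i, i + 1}` is the horizontal quadrant between the
consecutive ends `i` and `i + 1`, the square `{0, 2}` is a vertical wing attached from above along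
the over-strand, and the square `{1, 3}` is a vertical wing attached from below along the
under-strand. -/
def Butterfly : Type :=
  {x : Fin 4 → unitInterval // ∃ i j, ∀ k, k ≠ i → k ≠ j → x k = 0}

instance : TopologicalSpace Butterfly :=
  inferInstanceAs (TopologicalSpace
    {x : Fin 4 → unitInterval // ∃ i j, ∀ k, k ≠ i → k ≠ j → x k = 0})

/-- The three sheets incident to the half-edge `i`, in the counterclockwise order in which they are
seen by an observer who stands at the vertex and looks outwards along `i`, starting from
the vertical wing (which is above the half-edge if `i` is even, below it if `i` is odd).
A sheet at `i` is named by its second half-edge `j`, so that it is the square `{i, j}`;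
the quadrant `{i, i + 1}` is on the left of the observer and `{i, i - 1}` is on the right. -/
def sheet (i : Fin 4) (g : ZMod 3) : Fin 4 :=
  if g = 0 then i + 2
  else if (Even (i : ℕ) ↔ g = 1) then i + 1
  else i - 1

namespace OGraph

variable {V : Type*}

/-- The gluing of the neighbourhoods of the vertices along an edge of colour `c` with ends `(v, i)`
and `(w, j)`. The boundary tripod `{x i = 1}` at the first end is glued to the boundary tripod
`{y j = 1}` at the second end, through the homeomorphism which sends the leg number `g`
to the leg number `c - g`. Since observers at the two ends look in opposite directions, this
preserves the screw orientation along the edge. For `c = 0` the wing is glued to the wing; colour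
`c` adds a right-handed screw of `c` thirds of a turn. -/
def Glue (Γ : OGraph V) (p q : Σ _ : V, Butterfly) : Prop :=
  ∃ i j : Fin 4, Γ.opp (p.1, i) = (q.1, j) ∧ p.2.1 i = 1 ∧ q.2.1 j = 1 ∧
    ∀ g : ZMod 3, q.2.1 (sheet j (Γ.colour (p.1, i) - g)) = p.2.1 (sheet i g)

/-- The standard polyhedron defined by an o-graph, as a topological space: the quotient of
the disjoint union of the neighbourhoods of the vertices by the equivalence relation
generated by the gluings (`Quot` carries the quotient topology). -/
abbrev Polyhedron (Γ : OGraph V) : Type _ := Quot Γ.Glue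

/-- The singular set `S(P)` of the polyhedron: the embedded 4-valent graph formed by the vertices
and the (triple) edges. -/
def singularSet (Γ : OGraph V) : Set Γ.Polyhedron :=
  {P | ∃ p : Σ _ : V, Butterfly, Quot.mk Γ.Glue p = P ∧ ∃ i, ∀ k, k ≠ i → p.2.1 k = 0}

/-- The faces of the polyhedron: the connected components of the complement of `S(P)`. -/
abbrev Face (Γ : OGraph V) : Type _ :=
  ConnectedComponents {P : Γ.Polyhedron // P ∉ Γ.singularSet}

/-- The polyhedron has exactly one face. -/
def HasSingleFace (Γ : OGraph V) : Prop := Nat.card Γ.Face = 1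

end OGraph

/-- The end of the open chain joined to a given end. The vertices are placed from left to right
on a line; the four ends at a vertex are, in counterclockwise order, `0` = upper left, `1` = lower
left, `2` = lower right, `3` = upper right. -/
def openChainOpp (m : ℕ) (h : Fin (m + 1) × Fin 4) : Fin (m + 1) × Fin 4 :=
  match h.2 with
  | 0 => Fin.cases (0, 1) (fun k : Fin m => (k.castSucc, 3)) h.1
  | 1 => Fin.cases (0, 0) (fun k : Fin m => (k.castSucc, 2)) h.1
  | 2 => Fin.lastCases (Fin.last m, 3) (fun k : Fin m => (k.succ, 1)) h.1
  | 3 => Fin.lastCases (Fin.last m, 2) (fun k : Fin m => (k.succ, 0)) h.1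

/-- The colours on the open chain: `α` on the left loop, `δ` on the right loop, and `β k`, `γ k` on
the upper and on the lower edge between two consecutive vertices. -/
def openChainColour {m : ℕ} (α δ : ZMod 3) (β γ : Fin m → ZMod 3)
    (h : Fin (m + 1) × Fin 4) : ZMod 3 :=
  match h.2 with
  | 0 => Fin.cases α β h.1
  | 1 => Fin.cases α γ h.1
  | 2 => Fin.lastCases δ γ h.1
  | 3 => Fin.lastCases δ β h.1

/-- The o-graph on the open chain `G_n`, `n = m + 1`, with colours `α, δ, β k, γ k`. At each vertex
the strand from the upper left to the lower right is over the other one. -/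
def openChain {m : ℕ} (α δ : ZMod 3) (β γ : Fin m → ZMod 3) : OGraph (Fin (m + 1)) where
  finite_vertices := inferInstance
  opp := openChainOpp m
  opp_opp := by
    rintro ⟨v, e⟩
    fin_cases e
    · cases v using Fin.cases <;> simp [openChainOpp]
    · cases v using Fin.cases <;> simp [openChainOpp]
    · cases v using Fin.lastCases <;> simp [openChainOpp]
    · cases v using Fin.lastCases <;> simp [openChainOpp]
  opp_ne := by
    rintro ⟨v, e⟩
    fin_cases e
    · cases v using Fin.cases <;> simp [openChainOpp]
    · cases v using Fin.cases <;> simp [openChainOpp]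
    · cases v using Fin.lastCases <;> simp [openChainOpp]
    · cases v using Fin.lastCases <;> simp [openChainOpp]
  colour := openChainColour α δ β γ
  colour_opp := by
    rintro ⟨v, e⟩
    fin_cases e
    · cases v using Fin.cases <;> simp [openChainOpp, openChainColour]
    · cases v using Fin.cases <;> simp [openChainOpp, openChainColour]
    · cases v using Fin.lastCases <;> simp [openChainOpp, openChainColour]
    · cases v using Fin.lastCases <;> simp [openChainOpp, openChainColour]

/-- The states of the automaton. -/
inductive ChainState
  | XYYX
  | XXYY
  | XYXY
  | FAIL

def alphabet0 : Finset (ZMod 3 × ZMod 3) := {(2, 2)}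

def alphabet1 : Finset (ZMod 3 × ZMod 3) := {(0, 0), (1, 1)}

def alphabet2 : Finset (ZMod 3 × ZMod 3) := {(1, 0), (0, 1)}

def alphabet3 : Finset (ZMod 3 × ZMod 3) := {(0, 2), (1, 2), (2, 0), (2, 1)}

/-- The transition function of the automaton; `alphabet0`, ..., `alphabet3` partition the
nine letters. -/
def chainStep : ChainState → ZMod 3 × ZMod 3 → ChainState
  | .XYYX, a => if a ∈ alphabet2 ∪ alphabet3 then .XXYY else .FAIL
  | .XXYY, a =>
      if a ∈ alphabet1 then .XYYX
      else if a ∈ alphabet2 then .XXYY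
      else if a ∈ alphabet3 then .XYXY
      else .FAIL
  | .XYXY, a => if a ∈ alphabet1 ∪ alphabet3 then .XYYX else .FAIL
  | .FAIL, _ => .FAIL

/-- The automaton, with start state `XYYX` and accept states `XXYY` and `XYXY`. -/
def chainAutomaton : DFA (ZMod 3 × ZMod 3) ChainState where
  step := chainStep
  start := .XYYX
  accept := {.XXYY, .XYXY}

/-! Off the singular set, the polyhedron consists of the coordinate squares without their axes,
glued along the legs of the tripods. Hence there is one face exactly when every two-valued labelling
of the squares that respects the gluings is constant (`OGraph.hasSingleFace_iff`).

At a vertex of the chain the square `{0, 1}` meets only the left ends, `{2, 3}` only the right ends,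
and the other four squares cross from left to right. The gluings on the left join the four crossing
squares in pairs. A state of the automaton is this matching, its letters standing for `{0, 2}`, `{1,
2}`, `{0, 3}`, `{1, 3}` in this order; `FAIL` means that a face has already closed up on the left.

The left loop closes `{0, 1}` on itself if `α = 2`, and otherwise gives the matching `XYYX`. Between
consecutive vertices, the two old pairs, the old `{2, 3}` and the new `{0, 1}` have two legs each,
and the new crossing squares one each. They form two paths, whose ends give the new matching, and
possibly a cycle, which is `FAIL`; as legs join old to new, a cycle contains the new `{0, 1}`. The
right loop closes `{2, 3}` on itself if `δ = 2`; otherwise it again pairs the squares as `XYYX`, so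
everything becomes one cycle exactly when the state is a different matching.

Each single step is a finite check, and induction on the length assembles them:
`IsHalfChain.matches` shows that labels are forced, while `exists_isHalfChain` and
`exists_isHalfChain_of_fail` construct labellings. -/

/-- The labels `f` and `g` of the squares at two vertices agree along an edge of colour `c` which
joins the end `i` of the first vertex to the end `j` of the second one. -/
def Glued (f g : Fin 4 → Fin 4 → Bool) (i j : Fin 4) (c : ZMod 3) : Prop :=
  ∀ s, g j (sheet j (c - s)) = f i (sheet i s)

theorem Glued.symm {f g : Fin 4 → Fin 4 → Bool} {i j : Fin 4} {c : ZMod 3}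
    (h : Glued f g i j c) : Glued g f j i c := by
  intro s
  have := h (c - s)
  rw [sub_sub_cancel] at this
  exact this.symm

theorem sheet_ne (i : Fin 4) (g : ZMod 3) : sheet i g ≠ i := by
  revert i g; decide

theorem sheet_injective (i : Fin 4) : Function.Injective (sheet i) := by
  revert i; unfold Function.Injective; decide

theorem exists_sheet_eq {i j : Fin 4} (h : j ≠ i) : ∃ g, sheet i g = j := by
  revert i j; decide

/-! ### Coordinates on the local squares. -/

namespace Butterfly

/-- The point with coordinates `a`, `b` in the square on the axes `i`, `j`. -/
def square (i j : Fin 4) (a b : unitInterval) : Butterfly :=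
  ⟨fun k => if k = i then a else if k = j then b else 0, i, j, fun k hi hj => by simp [hi, hj]⟩

theorem square_apply (i j k : Fin 4) (a b : unitInterval) :
    (square i j a b).1 k = if k = i then a else if k = j then b else 0 := rfl

theorem square_left (i j : Fin 4) (a b : unitInterval) : (square i j a b).1 i = a := by
  simp [square_apply]

theorem square_right {i j : Fin 4} (h : i ≠ j) (a b : unitInterval) :
    (square i j a b).1 j = b := by
  simp [square_apply, h.symm]

theorem square_comm {i j : Fin 4} (h : i ≠ j) (a b : unitInterval) :
    square i j a b = square j i b a := by
  apply Subtype.ext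
  funext k
  simp only [square_apply]
  split_ifs <;> simp_all

/-- A point has no further nonzero coordinates than two given ones. -/
theorem eq_zero_of_ne {p : Butterfly} {i j k : Fin 4} (hij : i ≠ j) (hi : p.1 i ≠ 0)
    (hj : p.1 j ≠ 0) (hki : k ≠ i) (hkj : k ≠ j) : p.1 k = 0 := by
  obtain ⟨a, b, hab⟩ := p.2
  by_contra hk
  have hi' : i = a ∨ i = b := by by_contra! h; exact hi (hab i h.1 h.2)
  have hj' : j = a ∨ j = b := by by_contra! h; exact hj (hab j h.1 h.2)
  have hk' : k = a ∨ k = b := by by_contra! h; exact hk (hab k h.1 h.2)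
  grind

theorem eq_square {p : Butterfly} {i j : Fin 4} (hij : i ≠ j) (hi : p.1 i ≠ 0)
    (hj : p.1 j ≠ 0) : p = square i j (p.1 i) (p.1 j) := by
  apply Subtype.ext
  funext k
  rw [square_apply]
  split_ifs with h1 h2
  · rw [h1]
  · rw [h2]
  · exact eq_zero_of_ne hij hi hj h1 h2

theorem continuous_square (i j : Fin 4) :
    Continuous fun x : unitInterval × unitInterval => square i j x.1 x.2 := by
  refine Continuous.subtype_mk (continuous_pi fun k => ?_) _
  split_ifs <;> fun_prop

theorem continuous_coord (i : Fin 4) : Continuous fun p : Butterfly => p.1 i :=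
  (continuous_apply i).comp continuous_subtype_val

end Butterfly

/-! ### Faces as classes of glued squares. -/

namespace OGraph

variable {V : Type*} (Γ : OGraph V)

theorem Glue.symm {Γ : OGraph V} {p q : Σ _ : V, Butterfly} (h : Γ.Glue p q) : Γ.Glue q p := by
  obtain ⟨i, j, ho, hp, hq, hg⟩ := h
  refine ⟨j, i, by rw [← ho, Γ.opp_opp], hq, hp, fun g => ?_⟩
  rw [← ho, Γ.colour_opp]
  have := hg (Γ.colour (p.1, i) - g)
  rw [sub_sub_cancel] at this
  exact this.symm

/-- A two-valued function on the coordinate squares that takes the same value on squares which are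
glued to each other along a leg of a tripod. -/
structure IsFaceColouring (f : V → Fin 4 → Fin 4 → Bool) : Prop where
  comm : ∀ v i j, f v i j = f v j i
  glued : ∀ v i w j, Γ.opp (v, i) = (w, j) → Glued (f v) (f w) i j (Γ.colour (v, i))

/-- The point `p` lies in the interior of the face formed by a square of value `b`. -/
def HasColour (f : V → Fin 4 → Fin 4 → Bool) (b : Bool) (p : Σ _ : V, Butterfly) : Prop :=
  ∃ i j, i ≠ j ∧ p.2.1 i ≠ 0 ∧ p.2.1 j ≠ 0 ∧ f p.1 i j = b

variable {Γ} {f : V → Fin 4 → Fin 4 → Bool}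

/-- A glued point has coordinate 1 on its half-edge, so its other nonzero coordinate singles out a
leg, and the labels agree across that leg. -/
theorem IsFaceColouring.hasColour_of_glue (hf : Γ.IsFaceColouring f) {b : Bool}
    {p q : Σ _ : V, Butterfly} (h : Γ.Glue p q) (hp : HasColour f b p) : HasColour f b q := by
  obtain ⟨i, j, ho, hpi, hqj, hg⟩ := h
  obtain ⟨k, hk, hk0, hkb⟩ : ∃ k, k ≠ i ∧ p.2.1 k ≠ 0 ∧ f p.1 i k = b := by
    obtain ⟨a, c, hac, ha, hc, hb⟩ := hp
    by_cases hia : i = a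
    · exact ⟨c, by rw [hia]; exact hac.symm, hc, by rw [hia]; exact hb⟩
    by_cases hic : i = c
    · exact ⟨a, by rw [hic]; exact hac, ha, by rw [hic, hf.comm]; exact hb⟩
    have := Butterfly.eq_zero_of_ne hac ha hc hia hic
    rw [hpi] at this
    exact absurd this one_ne_zero
  obtain ⟨g, rfl⟩ := exists_sheet_eq hk
  refine ⟨j, sheet j (Γ.colour (p.1, i) - g), (sheet_ne _ _).symm, by rw [hqj]; exact one_ne_zero,
    by rw [hg]; exact hk0, ?_⟩
  rw [hf.glued _ _ _ _ ho g, hkb]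

theorem HasColour.unique (hf : Γ.IsFaceColouring f) {b c : Bool}
    {p : Σ _ : V, Butterfly} (hb : HasColour f b p) (hc : HasColour f c p) : b = c := by
  obtain ⟨i, j, hij, hi, hj, rfl⟩ := hb
  obtain ⟨k, l, hkl, hk, hl, rfl⟩ := hc
  have h1 : k = i ∨ k = j := by
    by_contra! h; exact hk (Butterfly.eq_zero_of_ne hij hi hj h.1 h.2)
  have h2 : l = i ∨ l = j := by
    by_contra! h; exact hl (Butterfly.eq_zero_of_ne hij hi hj h.1 h.2)
  have := hf.comm p.1 i j
  rcases h1 with rfl | rfl <;> rcases h2 with rfl | rfl <;> simp_all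

/-- The points of the polyhedron that lie in the interior of faces of value `b`. -/
def IsFaceColouring.colourSet (hf : Γ.IsFaceColouring f) (b : Bool) : Set Γ.Polyhedron :=
  Quot.lift (HasColour f b) fun _ _ h =>
    propext ⟨hf.hasColour_of_glue h, hf.hasColour_of_glue h.symm⟩

theorem IsFaceColouring.mk_mem_colourSet (hf : Γ.IsFaceColouring f) {b : Bool}
    {p : Σ _ : V, Butterfly} : Quot.mk Γ.Glue p ∈ hf.colourSet b ↔ HasColour f b p := Iff.rfl

theorem IsFaceColouring.isOpen_colourSet (hf : Γ.IsFaceColouring f) (b : Bool) :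
    IsOpen (hf.colourSet b) := by
  refine isOpen_coinduced.2 (isOpen_sigma_iff.2 fun v => ?_)
  have : (Sigma.mk (β := fun _ => Butterfly) v ⁻¹' (Quot.mk Γ.Glue ⁻¹' hf.colourSet b)) =
      ⋃ i, ⋃ j, ⋃ _ : i ≠ j ∧ f v i j = b, {x : Butterfly | x.1 i ≠ 0} ∩ {x | x.1 j ≠ 0} := by
    ext x
    simp only [Set.mem_preimage, hf.mk_mem_colourSet, HasColour, Set.mem_iUnion, Set.mem_inter_iff,
      Set.mem_ofPred_eq, exists_prop]
    constructor
    · rintro ⟨i, j, h1, h2, h3, h4⟩; exact ⟨i, j, ⟨h1, h4⟩, h2, h3⟩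
    · rintro ⟨i, j, ⟨h1, h4⟩, h2, h3⟩; exact ⟨i, j, h1, h2, h3, h4⟩
  rw [this]
  refine isOpen_iUnion fun i => isOpen_iUnion fun j => isOpen_iUnion fun _ => ?_
  exact (isOpen_ne.preimage (Butterfly.continuous_coord i)).inter
    (isOpen_ne.preimage (Butterfly.continuous_coord j))

/-- A representative of a point outside the singular set has two nonzero coordinates. -/
theorem exists_ne_zero_of_notMem_singularSet {p : Σ _ : V, Butterfly}
    (h : Quot.mk Γ.Glue p ∉ Γ.singularSet) : ∃ i j, i ≠ j ∧ p.2.1 i ≠ 0 ∧ p.2.1 j ≠ 0 := by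
  have h' : ∀ i, ∃ k, k ≠ i ∧ p.2.1 k ≠ 0 := by
    intro i
    by_contra! hi
    exact h ⟨p, rfl, i, hi⟩
  obtain ⟨k, -, hk⟩ := h' 0
  obtain ⟨l, hl, hl0⟩ := h' k
  exact ⟨l, k, hl, hl0, hk⟩

theorem isFaceColouring_const (b : Bool) : Γ.IsFaceColouring fun _ _ _ => b :=
  ⟨fun _ _ _ => rfl, fun _ _ _ _ _ _ => rfl⟩

theorem notMem_singularSet {p : Σ _ : V, Butterfly} {i j : Fin 4} (hij : i ≠ j)
    (hi : p.2.1 i ≠ 0) (hj : p.2.1 j ≠ 0) : Quot.mk Γ.Glue p ∉ Γ.singularSet := by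
  rintro ⟨q, hq, k, hk⟩
  -- For the constant labelling, having a colour just means having two nonzero coordinates. Its
  -- invariance under gluing transfers this property to every representative.
  have hf := isFaceColouring_const (Γ := Γ) true
  have hp : Quot.mk Γ.Glue p ∈ hf.colourSet true := ⟨i, j, hij, hi, hj, rfl⟩
  rw [← hq] at hp
  obtain ⟨a, b, hab, ha, hb, -⟩ := hp
  refine hab (Eq.trans (b := k) ?_ ?_)
  · by_contra h; exact ha (hk a h)
  · by_contra h; exact hb (hk b (Ne.symm h))

variable (Γ) in
/-- The points of the polyhedron outside the singular set. -/
abbrev Regular : Type _ := {P : Γ.Polyhedron // P ∉ Γ.singularSet}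

variable (Γ) in
/-- The centre of the face that contains a given coordinate square. -/
def corner (v : V) {i j : Fin 4} (h : i ≠ j) : Γ.Regular :=
  ⟨Quot.mk _ ⟨v, Butterfly.square i j 1 1⟩, notMem_singularSet h
    (by rw [Butterfly.square_left]; exact one_ne_zero)
    (by rw [Butterfly.square_right h]; exact one_ne_zero)⟩

theorem corner_comm (v : V) {i j : Fin 4} (h : i ≠ j) : Γ.corner v h = Γ.corner v h.symm := by
  apply Subtype.ext
  simp only [corner, Butterfly.square_comm h]

/-- The corner `(1, 1)` of a square is the outer end of the tripod leg in that square, so the gluing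
of legs identifies the corners. -/
theorem corner_glue {v w : V} {i j : Fin 4} (h : Γ.opp (v, i) = (w, j)) (s : ZMod 3) :
    Γ.corner w (sheet_ne j (Γ.colour (v, i) - s)).symm = Γ.corner v (sheet_ne i s).symm := by
  apply Subtype.ext
  refine (Quot.sound ⟨i, j, h, Butterfly.square_left _ _ _ _, Butterfly.square_left _ _ _ _,
    fun g => ?_⟩).symm
  simp only [Butterfly.square_apply, sheet_ne, if_false, (sheet_injective _).eq_iff, sub_right_inj]

/-- The function induced on squares by a locally constant function on the regular points. -/
theorem isFaceColouring_of_regular (F : Γ.Regular → Bool) :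
    Γ.IsFaceColouring fun v i j => if h : i ≠ j then F (Γ.corner v h) else true where
  comm v i j := by
    by_cases h : i = j
    · simp [h]
    · rw [dif_pos h, dif_pos (Ne.symm h), corner_comm v h]
  glued v i w j h s := by
    beta_reduce
    rw [dif_pos (sheet_ne _ _).symm, dif_pos (sheet_ne _ _).symm, corner_glue h]

/-- A continuous two-valued function is constant on the interior of a square. -/
theorem apply_eq_apply_corner {F : Γ.Regular → Bool} (hF : Continuous F) {p : Σ _ : V, Butterfly}
    {i j : Fin 4} (hij : i ≠ j) (hi : p.2.1 i ≠ 0) (hj : p.2.1 j ≠ 0) :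
    F ⟨Quot.mk _ p, notMem_singularSet hij hi hj⟩ = F (Γ.corner p.1 hij) := by
  -- The square without its two axes is a product of half-open intervals, hence connected, and it
  -- contains the corner.
  let T : Type := Set.Ioc (0 : ℝ) 1
  have : PreconnectedSpace T := Subtype.preconnectedSpace isPreconnected_Ioc
  let e : T → unitInterval := fun t => ⟨t.1, t.2.1.le, t.2.2⟩
  have he : Continuous e := Continuous.subtype_mk continuous_subtype_val _
  have he0 (t : T) : e t ≠ 0 := fun h => t.2.1.ne' (congrArg Subtype.val h)
  have hs (x : unitInterval) (hx : x ≠ 0) : ∃ t, e t = x :=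
    ⟨⟨x.1, lt_of_le_of_ne x.2.1 fun h => hx (Subtype.ext h.symm), x.2.2⟩, rfl⟩
  let G : T × T → Γ.Regular := fun x =>
    ⟨Quot.mk _ ⟨p.1, Butterfly.square i j (e x.1) (e x.2)⟩, notMem_singularSet hij
      (by rw [Butterfly.square_left]; exact he0 _) (by rw [Butterfly.square_right hij]; exact he0 _)⟩
  have hG : Continuous G := by
    refine Continuous.subtype_mk (continuous_quot_mk.comp (continuous_sigmaMk.comp ?_)) _
    exact (Butterfly.continuous_square i j).comp (he.prodMap he)
  obtain ⟨a, ha⟩ := hs _ hi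
  obtain ⟨b, hb⟩ := hs _ hj
  obtain ⟨c, hc⟩ := hs 1 one_ne_zero
  have h1 : G (a, b) = ⟨Quot.mk _ p, notMem_singularSet hij hi hj⟩ := by
    apply Subtype.ext
    simp only [G, ha, hb]
    rw [← Butterfly.eq_square hij hi hj]
  have h2 : G (c, c) = Γ.corner p.1 hij := by
    apply Subtype.ext
    simp only [G, hc, corner]
  rw [← h1, ← h2]
  exact PreconnectedSpace.constant inferInstance (hF.comp hG)

theorem hasSingleFace_iff_connectedSpace : Γ.HasSingleFace ↔ ConnectedSpace Γ.Regular := by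
  rw [HasSingleFace, Nat.card_eq_one_iff_unique]
  constructor
  · rintro ⟨h1, ⟨x⟩⟩
    have : PreconnectedSpace Γ.Regular := by
      refine preconnectedSpace_iff_connectedComponent.2 fun x => ?_
      ext y
      simp only [Set.mem_univ, iff_true]
      rw [← connectedComponent_eq_iff_mem]
      exact ConnectedComponents.coe_eq_coe.1 (Subsingleton.elim _ _)
    obtain ⟨x, -⟩ := ConnectedComponents.surjective_coe x
    exact { toNonempty := ⟨x⟩ }
  · intro h
    refine ⟨⟨fun x y => ?_⟩, ⟨((Classical.arbitrary Γ.Regular : Γ.Regular) : Γ.Face)⟩⟩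
    obtain ⟨x, rfl⟩ := ConnectedComponents.surjective_coe x
    obtain ⟨y, rfl⟩ := ConnectedComponents.surjective_coe y
    rw [ConnectedComponents.coe_eq_coe, PreconnectedSpace.connectedComponent_eq_univ,
      PreconnectedSpace.connectedComponent_eq_univ]

/-- The polyhedron has a single face if and only if each face colouring of its squares is
constant. -/
theorem hasSingleFace_iff [Nonempty V] : Γ.HasSingleFace ↔ ∀ f, Γ.IsFaceColouring f →
    ∃ b, ∀ v i j, i ≠ j → f v i j = b := by
  rw [hasSingleFace_iff_connectedSpace]
  constructor
  · intro h f hf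
    have hU (b : Bool) : IsOpen ((↑) ⁻¹' hf.colourSet b : Set Γ.Regular) :=
      (hf.isOpen_colourSet b).preimage continuous_subtype_val
    -- The two colour sets are open and complementary, so both are clopen.
    have hc : ((↑) ⁻¹' hf.colourSet false : Set Γ.Regular) = ((↑) ⁻¹' hf.colourSet true)ᶜ := by
      ext ⟨P, hP⟩
      induction P using Quot.ind with
      | mk p =>
        obtain ⟨i, j, hij, hi, hj⟩ := exists_ne_zero_of_notMem_singularSet hP
        simp only [Set.mem_preimage, Set.mem_compl_iff, hf.mk_mem_colourSet]
        constructor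
        · intro h1 h2
          exact Bool.false_ne_true (h1.unique hf h2)
        · intro h1
          refine ⟨i, j, hij, hi, hj, ?_⟩
          by_contra h2
          exact h1 ⟨i, j, hij, hi, hj, by simpa using h2⟩
    have hclopen : IsClopen ((↑) ⁻¹' hf.colourSet true : Set Γ.Regular) :=
      ⟨⟨hc ▸ hU false⟩, hU true⟩
    have key (v : V) (i j : Fin 4) (hij : i ≠ j) :
        (Γ.corner v hij : Γ.Polyhedron) ∈ hf.colourSet (f v i j) :=
      ⟨i, j, hij, by rw [Butterfly.square_left]; exact one_ne_zero,
        by rw [Butterfly.square_right hij]; exact one_ne_zero, rfl⟩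
    rcases isClopen_iff.1 hclopen with h0 | h1
    · refine ⟨false, fun v i j hij => ?_⟩
      by_contra hne
      have hk := key v i j hij
      rw [Bool.eq_true_of_not_eq_false hne] at hk
      exact (Set.ext_iff.1 h0 (Γ.corner v hij)).1 hk
    · refine ⟨true, fun v i j hij => ?_⟩
      by_contra hne
      have hk := key v i j hij
      rw [Bool.eq_false_of_not_eq_true hne] at hk
      exact (Set.ext_iff.1 hc (Γ.corner v hij)).1 hk ((Set.ext_iff.1 h1 (Γ.corner v hij)).2 trivial)
  · intro h
    have : PreconnectedSpace Γ.Regular := by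
      refine preconnectedSpace_of_forall_constant fun F hF => ?_
      obtain ⟨b, hb⟩ := h _ (isFaceColouring_of_regular F)
      have hFb (x : Γ.Regular) : F x = b := by
        obtain ⟨P, hP⟩ := x
        induction P using Quot.ind with
        | mk p =>
          obtain ⟨i, j, hij, hi, hj⟩ := exists_ne_zero_of_notMem_singularSet hP
          rw [apply_eq_apply_corner hF hij hi hj, ← hb p.1 i j hij, dif_pos hij]
      intro x y
      rw [hFb, hFb]
    exact { toNonempty := ⟨Γ.corner (Classical.arbitrary V) (i := 0) (j := 1) (by decide)⟩ }

end OGraph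

/-! ### Finite checks at one vertex or one pair of edges. -/

/-- A symmetric labelling of the squares at a vertex that takes the given values on the squares
`{0, 1}`, `{0, 2}`, `{0, 3}`, `{1, 2}`, `{1, 3}`, `{2, 3}`. -/
def squareLabels (a b c d e x : Bool) : Fin 4 → Fin 4 → Bool :=
  -- The diagonal names no square: its value is never used in a gluing, by `sheet_ne`.
  ![![true, a, b, c], ![a, true, d, e], ![b, d, true, x], ![c, e, x, true]]

theorem squareLabels_comm (a b c d e x : Bool) (i j : Fin 4) :
    squareLabels a b c d e x i j = squareLabels a b c d e x j i := by
  fin_cases i <;> fin_cases j <;> rfl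

/-- The labels of the four squares between the left and the right ends of a vertex agree along the
matching of these squares that a state of the automaton stands for. -/
def ChainState.Matches : ChainState → (Fin 4 → Fin 4 → Bool) → Prop
  | .XYYX, f => f 0 2 = f 1 3 ∧ f 0 3 = f 1 2
  | .XXYY, f => f 0 2 = f 1 2 ∧ f 0 3 = f 1 3
  | .XYXY, f => f 0 2 = f 0 3 ∧ f 1 2 = f 1 3
  | .FAIL, _ => False

/-- The labels of the squares at the two right ends of a vertex are equal to `b`. -/
def RightConst (b : Bool) (f : Fin 4 → Fin 4 → Bool) : Prop :=
  f 0 2 = b ∧ f 0 3 = b ∧ f 1 2 = b ∧ f 1 3 = b ∧ f 2 3 = b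

/-- This form makes gluing decidable by comparing three legs. -/
theorem glued_iff {f g : Fin 4 → Fin 4 → Bool} {i j : Fin 4} {c : ZMod 3} :
    Glued f g i j c ↔ g j (sheet j c) = f i (sheet i 0) ∧ g j (sheet j (c - 1)) = f i (sheet i 1) ∧
      g j (sheet j (c - 2)) = f i (sheet i 2) := by
  constructor
  · intro h
    have h0 := h 0
    rw [sub_zero] at h0
    exact ⟨h0, h 1, h 2⟩
  · rintro ⟨h0, h1, h2⟩ s
    have hs : s = 0 ∨ s = 1 ∨ s = 2 := by revert s; decide
    rcases hs with rfl | rfl | rfl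
    · rwa [sub_zero]
    · exact h1
    · exact h2

instance {f g : Fin 4 → Fin 4 → Bool} {i j : Fin 4} {c : ZMod 3} : Decidable (Glued f g i j c) :=
  decidable_of_iff' _ glued_iff

theorem squareLabels_eq {f : Fin 4 → Fin 4 → Bool} (hf : ∀ i j, f i j = f j i) {i j : Fin 4}
    (h : j ≠ i) :
    squareLabels (f 0 1) (f 0 2) (f 0 3) (f 1 2) (f 1 3) (f 2 3) i j = f i j := by
  fin_cases i <;> fin_cases j <;> first | exact absurd rfl h | rfl | exact hf _ _

theorem Glued.squareLabels {f g : Fin 4 → Fin 4 → Bool} (hf : ∀ i j, f i j = f j i)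
    (hg : ∀ i j, g i j = g j i) {i j : Fin 4} {c : ZMod 3} (h : Glued f g i j c) :
    Glued (squareLabels (f 0 1) (f 0 2) (f 0 3) (f 1 2) (f 1 3) (f 2 3))
      (squareLabels (g 0 1) (g 0 2) (g 0 3) (g 1 2) (g 1 3) (g 2 3)) i j c := fun s => by
  rw [squareLabels_eq hf (sheet_ne _ _), squareLabels_eq hg (sheet_ne _ _), h s]

instance (s : ChainState) (f : Fin 4 → Fin 4 → Bool) : Decidable (s.Matches f) := by
  cases s <;> unfold ChainState.Matches <;> infer_instance

instance (b : Bool) (f : Fin 4 → Fin 4 → Bool) : Decidable (RightConst b f) := by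
  unfold RightConst; infer_instance

instance : DecidableEq ChainState := fun s t => by
  cases s <;> cases t <;> first | exact isTrue rfl | exact isFalse nofun

/-- Labels extend backwards along the two paths. The old `{0, 1}` touches no right end, so its label
`g01` stays free, to be fixed by the part further left. -/
theorem step_exists (s : ChainState) : ∀ b c : ZMod 3, chainStep s (b, c) ≠ .FAIL →
    ∀ h02 h03 h12 h13 h23,
      (chainStep s (b, c)).Matches (squareLabels true h02 h03 h12 h13 h23) →
      ∃ h01 g02 g03 g12 g13 g23, ∀ g01,
        s.Matches (squareLabels g01 g02 g03 g12 g13 g23) ∧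
        Glued (squareLabels g01 g02 g03 g12 g13 g23) (squareLabels h01 h02 h03 h12 h13 h23) 3 0 b ∧
        Glued (squareLabels g01 g02 g03 g12 g13 g23) (squareLabels h01 h02 h03 h12 h13 h23) 2 1 c := by
  cases s <;> decide +kernel

/-- A cycle contains the new `{0, 1}` but no new crossing square, so it can be labelled `false` and
the rest `true`. -/
theorem step_fail (s : ChainState) (hs : s ≠ .FAIL) : ∀ b c : ZMod 3, chainStep s (b, c) = .FAIL →
    ∃ g02 g03 g12 g13 g23, ∀ g01, s.Matches (squareLabels g01 g02 g03 g12 g13 g23) ∧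
      Glued (squareLabels g01 g02 g03 g12 g13 g23)
        (squareLabels false true true true true true) 3 0 b ∧
      Glued (squareLabels g01 g02 g03 g12 g13 g23)
        (squareLabels false true true true true true) 2 1 c := by
  cases s <;> first | exact absurd rfl hs | decide +kernel

theorem loop_exists : ∀ a : ZMod 3, a ≠ 2 → ∀ h02 h03 h12 h13 h23,
    ChainState.XYYX.Matches (squareLabels true h02 h03 h12 h13 h23) → ∃ h01,
      Glued (squareLabels h01 h02 h03 h12 h13 h23) (squareLabels h01 h02 h03 h12 h13 h23) 0 1 a := by
  decide +kernel

theorem loop_two : Glued (squareLabels false true true true true true)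
    (squareLabels false true true true true true) 0 1 2 := by
  decide +kernel

/-- If `d = 2`, the square `{2, 3}` is separate; in state `XYYX`, the two matchings coincide and
leave two cycles. -/
theorem end_exists (s : ChainState) (hs : s ≠ .FAIL) : ∀ d : ZMod 3, d = 2 ∨ s = .XYYX →
    ∃ g02 g03 g12 g13 g23, ∀ g01, s.Matches (squareLabels g01 g02 g03 g12 g13 g23) ∧
      Glued (squareLabels g01 g02 g03 g12 g13 g23) (squareLabels g01 g02 g03 g12 g13 g23) 2 3 d ∧
      ∀ t, ¬ RightConst t (squareLabels g01 g02 g03 g12 g13 g23) := by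
  cases s <;> first | exact absurd rfl hs | decide +kernel

/-- Without a cycle, every old pair, the old `{2, 3}` and the new `{0, 1}` lie on paths ending at
new crossing squares, which force their labels. Matchings ignore `{0, 1}` and `{2, 3}`, so these get
the dummy value `true` in the first hypothesis, ahead of the remaining quantifiers. -/
theorem step_matches_squareLabels (s : ChainState) : ∀ b c : ZMod 3, chainStep s (b, c) ≠ .FAIL →
    ∀ f02 f03 f12 f13, s.Matches (squareLabels true f02 f03 f12 f13 true) →
    ∀ f01 f23 g01 g02 g03 g12 g13 g23,
      Glued (squareLabels f01 f02 f03 f12 f13 f23) (squareLabels g01 g02 g03 g12 g13 g23) 3 0 b →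
      Glued (squareLabels f01 f02 f03 f12 f13 f23) (squareLabels g01 g02 g03 g12 g13 g23) 2 1 c →
      (chainStep s (b, c)).Matches (squareLabels g01 g02 g03 g12 g13 g23) ∧
      ∀ t, RightConst t (squareLabels g01 g02 g03 g12 g13 g23) →
        RightConst t (squareLabels f01 f02 f03 f12 f13 f23) ∧ g01 = t := by
  cases s <;> decide +kernel

theorem loop_matches_squareLabels : ∀ a : ZMod 3, a ≠ 2 → ∀ h01 h02 h03 h12 h13 h23,
    Glued (squareLabels h01 h02 h03 h12 h13 h23) (squareLabels h01 h02 h03 h12 h13 h23) 0 1 a →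
    ChainState.XYYX.Matches (squareLabels h01 h02 h03 h12 h13 h23) ∧
    ∀ t, RightConst t (squareLabels h01 h02 h03 h12 h13 h23) → h01 = t := by
  decide +kernel

theorem end_matches_squareLabels (s : ChainState) : ∀ d : ZMod 3, d ≠ 2 → s ≠ .XYYX →
    ∀ g01 g02 g03 g12 g13 g23, s.Matches (squareLabels g01 g02 g03 g12 g13 g23) →
      Glued (squareLabels g01 g02 g03 g12 g13 g23) (squareLabels g01 g02 g03 g12 g13 g23) 2 3 d →
      ∃ t, RightConst t (squareLabels g01 g02 g03 g12 g13 g23) := by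
  cases s <;> decide +kernel

theorem ChainState.Matches.squareLabels {s : ChainState} {f : Fin 4 → Fin 4 → Bool}
    (h : s.Matches f) (a x : Bool) :
    s.Matches (squareLabels a (f 0 2) (f 0 3) (f 1 2) (f 1 3) x) := by
  cases s <;> exact h

theorem step_matches (s : ChainState) (b c : ZMod 3) (f g : Fin 4 → Fin 4 → Bool)
    (hf : ∀ i j, f i j = f j i) (hg : ∀ i j, g i j = g j i) (hs : s.Matches f)
    (hb : Glued f g 3 0 b) (hc : Glued f g 2 1 c) (hne : chainStep s (b, c) ≠ .FAIL) :
    (chainStep s (b, c)).Matches g ∧ ∀ t, RightConst t g → RightConst t f ∧ g 0 1 = t := by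
  have h := step_matches_squareLabels s b c hne _ _ _ _ (hs.squareLabels _ _) (f 0 1) (f 2 3)
    (g 0 1) (g 0 2) (g 0 3)
    (g 1 2) (g 1 3) (g 2 3) (hb.squareLabels hf hg) (hc.squareLabels hf hg)
  refine ⟨?_, h.2⟩
  have := h.1
  generalize chainStep s (b, c) = s' at this
  cases s' <;> exact this

theorem glued_squareLabels_true : ∀ (a : Bool) (c : ZMod 3),
    Glued (squareLabels a true true true true true)
      (squareLabels true true true true true true) 3 0 c ∧
    Glued (squareLabels a true true true true true)
      (squareLabels true true true true true true) 2 1 c := by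
  decide +kernel

theorem glued_end_true : ∀ (a : Bool) (d : ZMod 3),
    Glued (squareLabels a true true true true true) (squareLabels a true true true true true) 2 3 d := by
  decide +kernel

/-! ### Open chains without the right loop, which can be extended vertex by vertex. -/

/-- A function on the squares of the open chain that is compatible with all gluings except the one
along the right loop. -/
structure IsHalfChain {m : ℕ} (α : ZMod 3) (β γ : Fin m → ZMod 3)
    (f : Fin (m + 1) → Fin 4 → Fin 4 → Bool) : Prop where
  comm : ∀ v i j, f v i j = f v j i
  loop : Glued (f 0) (f 0) 0 1 α
  upper : ∀ k, Glued (f k.castSucc) (f k.succ) 3 0 (β k)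
  lower : ∀ k, Glued (f k.castSucc) (f k.succ) 2 1 (γ k)

theorem isFaceColouring_openChain_iff {m : ℕ} {α δ : ZMod 3} {β γ : Fin m → ZMod 3}
    {f : Fin (m + 1) → Fin 4 → Fin 4 → Bool} : (openChain α δ β γ).IsFaceColouring f ↔
      IsHalfChain α β γ f ∧ Glued (f (Fin.last m)) (f (Fin.last m)) 2 3 δ := by
  constructor
  · intro h
    refine ⟨⟨h.comm, ?_, fun k => ?_, fun k => ?_⟩, ?_⟩
    · simpa [openChain, openChainColour] using
        h.glued 0 0 0 1 (by simp [openChain, openChainOpp])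
    · simpa [openChain, openChainColour] using
        h.glued k.castSucc 3 k.succ 0 (by simp [openChain, openChainOpp])
    · simpa [openChain, openChainColour] using
        h.glued k.castSucc 2 k.succ 1 (by simp [openChain, openChainOpp])
    · simpa [openChain, openChainColour] using
        h.glued (Fin.last m) 2 (Fin.last m) 3 (by simp [openChain, openChainOpp])
  · rintro ⟨h, hδ⟩
    refine ⟨h.comm, fun v i w j ho => ?_⟩
    fin_cases i
    · cases v using Fin.cases with
      | zero =>
        obtain ⟨rfl, rfl⟩ : 0 = w ∧ 1 = j := by simpa [openChain, openChainOpp] using ho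
        simpa [openChain, openChainColour] using h.loop
      | succ k =>
        obtain ⟨rfl, rfl⟩ : k.castSucc = w ∧ 3 = j := by simpa [openChain, openChainOpp] using ho
        simpa [openChain, openChainColour] using (h.upper k).symm
    · cases v using Fin.cases with
      | zero =>
        obtain ⟨rfl, rfl⟩ : 0 = w ∧ 0 = j := by simpa [openChain, openChainOpp] using ho
        simpa [openChain, openChainColour] using h.loop.symm
      | succ k =>
        obtain ⟨rfl, rfl⟩ : k.castSucc = w ∧ 2 = j := by simpa [openChain, openChainOpp] using ho
        simpa [openChain, openChainColour] using (h.lower k).symm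
    · cases v using Fin.lastCases with
      | last =>
        obtain ⟨rfl, rfl⟩ : Fin.last m = w ∧ 3 = j := by simpa [openChain, openChainOpp] using ho
        simpa [openChain, openChainColour] using hδ
      | cast k =>
        obtain ⟨rfl, rfl⟩ : k.succ = w ∧ 1 = j := by simpa [openChain, openChainOpp] using ho
        simpa [openChain, openChainColour] using h.lower k
    · cases v using Fin.lastCases with
      | last =>
        obtain ⟨rfl, rfl⟩ : Fin.last m = w ∧ 2 = j := by simpa [openChain, openChainOpp] using ho
        simpa [openChain, openChainColour] using hδ.symm
      | cast k =>
        obtain ⟨rfl, rfl⟩ : k.succ = w ∧ 0 = j := by simpa [openChain, openChainOpp] using ho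
        simpa [openChain, openChainColour] using h.upper k

theorem isHalfChain_zero_iff {α : ZMod 3} {β γ : Fin 0 → ZMod 3}
    {f : Fin 1 → Fin 4 → Fin 4 → Bool} : IsHalfChain α β γ f ↔
      (∀ i j, f 0 i j = f 0 j i) ∧ Glued (f 0) (f 0) 0 1 α :=
  ⟨fun h => ⟨h.comm 0, h.loop⟩, fun h => ⟨Fin.forall_fin_one.2 h.1, h.2, nofun, nofun⟩⟩

theorem isHalfChain_snoc_iff {m : ℕ} {α : ZMod 3} {β γ : Fin (m + 1) → ZMod 3}
    {f : Fin (m + 1) → Fin 4 → Fin 4 → Bool} {g : Fin 4 → Fin 4 → Bool} :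
    IsHalfChain α β γ (Fin.snoc f g : Fin (m + 2) → Fin 4 → Fin 4 → Bool) ↔
      IsHalfChain α (fun k : Fin m => β k.castSucc) (fun k : Fin m => γ k.castSucc) f ∧
      (∀ i j, g i j = g j i) ∧ Glued (f (Fin.last m)) g 3 0 (β (Fin.last m)) ∧
      Glued (f (Fin.last m)) g 2 1 (γ (Fin.last m)) := by
  have h0 : (Fin.snoc f g : Fin (m + 2) → Fin 4 → Fin 4 → Bool) 0 = f 0 := by
    rw [← Fin.castSucc_zero, Fin.snoc_castSucc (α := fun _ => Fin 4 → Fin 4 → Bool)]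
  have hc (v : Fin (m + 1)) :
      (Fin.snoc f g : Fin (m + 2) → Fin 4 → Fin 4 → Bool) v.castSucc = f v :=
    Fin.snoc_castSucc (α := fun _ => Fin 4 → Fin 4 → Bool) _ _ _
  have hl : (Fin.snoc f g : Fin (m + 2) → Fin 4 → Fin 4 → Bool) (Fin.last _) = g :=
    Fin.snoc_last (α := fun _ => Fin 4 → Fin 4 → Bool) _ _
  constructor
  · intro h
    refine ⟨⟨fun v => ?_, ?_, fun k => ?_, fun k => ?_⟩, ?_, ?_, ?_⟩
    · simpa only [hc] using h.comm v.castSucc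
    · simpa only [h0] using h.loop
    · simpa only [hc, Fin.succ_castSucc] using h.upper k.castSucc
    · simpa only [hc, Fin.succ_castSucc] using h.lower k.castSucc
    · simpa only [hl] using h.comm (Fin.last _)
    · simpa only [hc, hl, Fin.succ_last] using h.upper (Fin.last _)
    · simpa only [hc, hl, Fin.succ_last] using h.lower (Fin.last _)
  · rintro ⟨h, hg, hu, hw⟩
    refine ⟨fun v => ?_, by rw [h0]; exact h.loop, fun k => ?_, fun k => ?_⟩
    · cases v using Fin.lastCases with
      | last => rw [hl]; exact hg
      | cast v => rw [hc]; exact h.comm v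
    · cases k using Fin.lastCases with
      | last => rw [hc, Fin.succ_last, hl]; exact hu
      | cast k => rw [hc, Fin.succ_castSucc, hc]; exact h.upper k
    · cases k using Fin.lastCases with
      | last => rw [hc, Fin.succ_last, hl]; exact hw
      | cast k => rw [hc, Fin.succ_castSucc, hc]; exact h.lower k

/-! ### Induction along the chain. -/

/-- The state that the automaton reaches on the colours of the edges between the vertices. -/
def chainState {m : ℕ} (β γ : Fin m → ZMod 3) : ChainState :=
  chainAutomaton.eval (List.ofFn fun k => (β k, γ k))

theorem chainState_succ {m : ℕ} (β γ : Fin (m + 1) → ZMod 3) : chainState β γ =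
    chainStep (chainState (fun k : Fin m => β k.castSucc) (fun k : Fin m => γ k.castSucc))
      (β (Fin.last m), γ (Fin.last m)) := by
  rw [chainState, List.ofFn_succ', List.concat_eq_append, DFA.eval_append_singleton]
  rfl

theorem forall_ne_of_rightConst {f : Fin 4 → Fin 4 → Bool} (hf : ∀ i j, f i j = f j i) {t : Bool}
    (h : RightConst t f) (h' : f 0 1 = t) {i j : Fin 4} (hij : i ≠ j) : f i j = t := by
  obtain ⟨h1, h2, h3, h4, h5⟩ := h
  rw [← squareLabels_eq hf hij.symm, h1, h2, h3, h4, h5, h']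
  clear h1 h2 h3 h4 h5 h'
  revert i j t
  decide

theorem IsHalfChain.matches {m : ℕ} {α : ZMod 3} {β γ : Fin m → ZMod 3}
    {f : Fin (m + 1) → Fin 4 → Fin 4 → Bool} (h : IsHalfChain α β γ f) (hα : α ≠ 2)
    (hs : chainState β γ ≠ .FAIL) : (chainState β γ).Matches (f (Fin.last m)) ∧
      ∀ t, RightConst t (f (Fin.last m)) → ∀ v i j, i ≠ j → f v i j = t := by
  induction m with
  | zero =>
    obtain ⟨hc, hl⟩ := isHalfChain_zero_iff.1 h
    obtain ⟨h1, h2⟩ := loop_matches_squareLabels α hα _ _ _ _ _ _ (hl.squareLabels hc hc)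
    refine ⟨h1, fun t ht => Fin.forall_fin_one.2 fun i j => ?_⟩
    exact forall_ne_of_rightConst hc ht (h2 t ht)
  | succ m ih =>
    induction f using Fin.snocCases with
    | snoc f g =>
      rw [isHalfChain_snoc_iff] at h
      obtain ⟨h, hg, hu, hw⟩ := h
      rw [chainState_succ] at hs ⊢
      -- `FAIL` is absorbing, so the shorter word has not failed either.
      have hs' : chainState (fun k : Fin m => β k.castSucc) (fun k : Fin m => γ k.castSucc) ≠
          .FAIL := fun h0 => hs (by rw [h0]; rfl)
      obtain ⟨h1, h2⟩ := ih h hs'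
      have hf := h.comm (Fin.last m)
      obtain ⟨h3, h4⟩ := step_matches _ _ _ _ _ hf hg h1 hu hw hs
      rw [Fin.snoc_last (α := fun _ => Fin 4 → Fin 4 → Bool)]
      refine ⟨h3, fun t ht v i j hij => ?_⟩
      obtain ⟨h5, h6⟩ := h4 t ht
      cases v using Fin.lastCases with
      | last =>
        rw [Fin.snoc_last (α := fun _ => Fin 4 → Fin 4 → Bool)]
        exact forall_ne_of_rightConst hg ht h6 hij
      | cast v =>
        rw [Fin.snoc_castSucc (α := fun _ => Fin 4 → Fin 4 → Bool)]
        exact h2 t h5 v i j hij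

theorem exists_isHalfChain {m : ℕ} {α : ZMod 3} {β γ : Fin m → ZMod 3} (hα : α ≠ 2)
    (hs : chainState β γ ≠ .FAIL) {b c d e x : Bool}
    (hm : (chainState β γ).Matches (squareLabels true b c d e x)) :
    ∃ a f, IsHalfChain α β γ f ∧ f (Fin.last m) = squareLabels a b c d e x := by
  induction m generalizing b c d e x with
  | zero =>
    obtain ⟨a, ha⟩ := loop_exists α hα b c d e x hm
    exact ⟨a, fun _ => squareLabels a b c d e x,
      isHalfChain_zero_iff.2 ⟨squareLabels_comm _ _ _ _ _ _, ha⟩, rfl⟩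
  | succ m ih =>
    rw [chainState_succ] at hs hm
    have hs' : chainState (fun k : Fin m => β k.castSucc) (fun k : Fin m => γ k.castSucc) ≠
        .FAIL := fun h0 => hs (by rw [h0]; rfl)
    obtain ⟨a, b', c', d', e', x', hg⟩ := step_exists _ _ _ hs _ _ _ _ _ hm
    obtain ⟨a', f, hf, hl⟩ := ih hs' (hg true).1
    refine ⟨a, Fin.snoc f (squareLabels a b c d e x), isHalfChain_snoc_iff.2
      ⟨hf, squareLabels_comm _ _ _ _ _ _, ?_⟩, Fin.snoc_last (α := fun _ => Fin 4 → Fin 4 → Bool) _ _⟩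
    rw [hl]
    exact (hg a').2

theorem exists_isHalfChain_of_fail {m : ℕ} {α : ZMod 3} {β γ : Fin m → ZMod 3}
    (h : α = 2 ∨ chainState β γ = .FAIL) : ∃ a f, IsHalfChain α β γ f ∧
      f (Fin.last m) = squareLabels a true true true true true ∧ ∃ v, f v 0 1 = false := by
  induction m with
  | zero =>
    rcases h with rfl | h
    · exact ⟨false, fun _ => squareLabels false true true true true true,
        isHalfChain_zero_iff.2 ⟨squareLabels_comm _ _ _ _ _ _, loop_two⟩, rfl, 0, rfl⟩
    · exact absurd h nofun
  | succ m ih =>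
    by_cases h0 : α = 2 ∨ chainState (fun k : Fin m => β k.castSucc)
        (fun k : Fin m => γ k.castSucc) = .FAIL
    -- A face has closed up earlier: the new vertex is labelled `true` throughout, and the old
    -- square `{0, 1}` keeps the label `false`.
    · obtain ⟨a, f, hf, hl, v, hv⟩ := ih h0
      refine ⟨true, Fin.snoc f (squareLabels true true true true true true),
        isHalfChain_snoc_iff.2 ⟨hf, squareLabels_comm _ _ _ _ _ _, ?_⟩,
        Fin.snoc_last (α := fun _ => Fin 4 → Fin 4 → Bool) _ _, v.castSucc, ?_⟩
      · rw [hl]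
        exact ⟨glued_squareLabels_true a _ |>.1, glued_squareLabels_true a _ |>.2⟩
      · rw [Fin.snoc_castSucc (α := fun _ => Fin 4 → Fin 4 → Bool), hv]
    · rw [not_or] at h0
      have hs := h.resolve_left h0.1
      rw [chainState_succ] at hs
      -- The first failure is at this step: its cycle is labelled by `step_fail`, and the labels are
      -- continued to the left.
      obtain ⟨b', c', d', e', x', hg⟩ := step_fail _ h0.2 _ _ hs
      obtain ⟨a', f, hf, hl⟩ := exists_isHalfChain h0.1 h0.2 (hg true).1
      refine ⟨false, Fin.snoc f (squareLabels false true true true true true),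
        isHalfChain_snoc_iff.2 ⟨hf, squareLabels_comm _ _ _ _ _ _, ?_⟩,
        Fin.snoc_last (α := fun _ => Fin 4 → Fin 4 → Bool) _ _, Fin.last _, ?_⟩
      · rw [hl]
        exact (hg a').2
      · rw [Fin.snoc_last (α := fun _ => Fin 4 → Fin 4 → Bool)]
        rfl

theorem mem_accepts_iff {m : ℕ} {β γ : Fin m → ZMod 3} :
    List.ofFn (fun k => (β k, γ k)) ∈ chainAutomaton.accepts ↔
      chainState β γ = .XXYY ∨ chainState β γ = .XYXY := Iff.rfl

theorem theorem2p2 (m : ℕ) (α δ : ZMod 3) (β γ : Fin m → ZMod 3) :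
    (openChain α δ β γ).HasSingleFace ↔
      α ≠ 2 ∧ δ ≠ 2 ∧ List.ofFn (fun k => (β k, γ k)) ∈ chainAutomaton.accepts := by
  rw [OGraph.hasSingleFace_iff, mem_accepts_iff]
  simp only [isFaceColouring_openChain_iff]
  constructor
  · intro h
    by_cases h0 : α = 2 ∨ chainState β γ = .FAIL
    · obtain ⟨a, f, hf, hl, v, hv⟩ := exists_isHalfChain_of_fail h0
      obtain ⟨b, hb⟩ := h f ⟨hf, by rw [hl]; exact glued_end_true a δ⟩
      have h1 := hb v 0 1 (by decide)
      have h2 := hb (Fin.last m) 0 2 (by decide)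
      rw [hv] at h1
      rw [hl] at h2
      exact absurd (h1.trans h2.symm) Bool.false_ne_true
    · rw [not_or] at h0
      -- Nothing has closed up on the left, so a second face can only come from the right loop.
      by_cases h1 : δ = 2 ∨ chainState β γ = .XYYX
      · obtain ⟨b', c', d', e', x', hg⟩ := end_exists _ h0.2 δ h1
        obtain ⟨a', f, hf, hl⟩ := exists_isHalfChain h0.1 h0.2 (hg true).1
        obtain ⟨b, hb⟩ := h f ⟨hf, by rw [hl]; exact (hg a').2.1⟩
        refine absurd ?_ ((hg a').2.2 b)
        rw [← hl]
        exact ⟨hb _ _ _ (by decide), hb _ _ _ (by decide), hb _ _ _ (by decide),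
          hb _ _ _ (by decide), hb _ _ _ (by decide)⟩
      · rw [not_or] at h1
        refine ⟨h0.1, h1.1, ?_⟩
        generalize chainState β γ = s at h0 h1
        cases s <;> simp_all
  · rintro ⟨hα, hδ, hs⟩ f ⟨hf, hl⟩
    have h1 : chainState β γ ≠ .FAIL := by rcases hs with hs | hs <;> rw [hs] <;> exact nofun
    have h2 : chainState β γ ≠ .XYYX := by rcases hs with hs | hs <;> rw [hs] <;> exact nofun
    obtain ⟨h3, h4⟩ := hf.matches hα h1
    have hc := hf.comm (Fin.last m)
    -- The matching and the right loop form one cycle, so all labels at the right ends agree; this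
    -- constant propagates to the left through `h4`.
    obtain ⟨t, ht⟩ := end_matches_squareLabels _ δ hδ h2 _ _ _ _ _ _
      (h3.squareLabels _ _) (hl.squareLabels hc hc)
    exact ⟨t, h4 t ht⟩
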